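/- Let $d\in\mathbb N$, $\alpha>0$, $\tau>0$ and $R\ge 0$. For $x\in\mathbb R^d$ let $\gamma_x=t(x,\tau^2 I,\alpha)$ be the multivariate Student's $t$ distribution, i.e. the probability measure on $\mathbb R^d$ with Lebesgue density proportional to $z\mapsto\bigl(1+\frac{\|z-x\|^2}{\alpha\tau^2}\bigr)^{-(\alpha+d)/2}$, and put $\gamma=\gamma_0$. Let $\omega(z)=1+\|z\|^2$. A probability measure $\mu$ on $\mathbb R^d$ is said to satisfy the weighted Poincaré inequality (with weight $\omega$) with constant $C\ge 0$ if $$\operatorname{Var}_\mu(f)\le C\int_{\mathbb R^d}\|\nabla f\|^2\,\omega\,\mathrm d\mu$$ for every continuously differentiable $f\in L^2(\mu)$ whose right-hand integral is finite. Set $$\kappa_R=\Bigl(\frac{\alpha+2\tau^{-2}(4R^2+1)}{\alpha}\Bigr)^{(\alpha+d)/2},\qquad \beta_R=\Bigl(1+\frac{4R^2}{\alpha\tau^2}+4R\Bigr)^{(\alpha+d)/2}.$$ Then there is a finite constant $C_{\mathrm{PI},\gamma}$ with which $\gamma_x$ satisfies the weighted Poincaré inequality for every $x$ with $\|x\|\le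 R$; if $\gamma$ satisfies it with constant $C$, then $C_{\mathrm{PI},\gamma}=(1+R+R^2)\,C$ is such a constant. Moreover, if $\tilde\pi$ is a probability measure supported in the closed ball $\{\|x\|\le R\}$, then $\pi=\tilde\pi*\gamma$ satisfies a weighted Poincaré inequality with weight $\omega$. More precisely, for every constant $C_{\mathrm{PI},\gamma}$ with which all $\gamma_x$, $\|x\|\le R$, satisfy the weighted Poincaré inequality, $\pi$ satisfies it with constant $$C_{\mathrm{PI},\gamma}\,(\kappa_R+\beta_R).$$ -/

import Mathlib

open MeasureTheory ProbabilityTheory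

/-- The multivariate Student's `t` distribution `t(m, τ² I, α)` on `ℝ^d`: the probability measure
whose Lebesgue density is proportional to `(1 + ‖z - m‖² / (α τ²)) ^ (-(α + d) / 2)`. -/
noncomputable def studentT (d : ℕ) (m : EuclideanSpace ℝ (Fin d)) (τ α : ℝ) :
    Measure (EuclideanSpace ℝ (Fin d)) :=
  let ν : Measure (EuclideanSpace ℝ (Fin d)) := volume.withDensity fun z =>
    ENNReal.ofReal ((1 + ‖z - m‖ ^ 2 / (α * τ ^ 2)) ^ (-(α + d) / 2))
  (ν Set.univ)⁻¹ • ν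

/-- `μ` satisfies the weighted Poincaré inequality with weight `ω` and constant `C`:
`Var_μ(f) ≤ C ∫ ‖∇f‖² ω dμ` for all continuously differentiable `f ∈ L²(μ)`
whose weighted energy on the right is finite (it is trivial for the others). -/
def WeightedPoincare {d : ℕ} (μ : Measure (EuclideanSpace ℝ (Fin d)))
    (ω : EuclideanSpace ℝ (Fin d) → ℝ) (C : ℝ) : Prop :=
  0 ≤ C ∧ ∀ f : EuclideanSpace ℝ (Fin d) → ℝ, ContDiff ℝ 1 f → MemLp f 2 μ →
    Integrable (fun z => ‖gradient f z‖ ^ 2 * ω z) μ →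
    variance f μ ≤ C * ∫ z, ‖gradient f z‖ ^ 2 * ω z ∂μ

/-- The weight `z ↦ 1 + ‖z‖²`. -/
noncomputable def quadWeight {d : ℕ} (z : EuclideanSpace ℝ (Fin d)) : ℝ := 1 + ‖z‖ ^ 2

/-- `κ_R = ((α + 2 (4 R² + 1) / τ²) / α) ^ ((α + d) / 2)`. -/
noncomputable def kappaR (d : ℕ) (τ α R : ℝ) : ℝ :=
  ((α + (τ ^ 2)⁻¹ * (2 * (4 * R ^ 2 + 1))) / α) ^ ((α + d) / 2)

/-- `β_R = (1 + 4 R² / (α τ²) + 4 R) ^ ((α + d) / 2)`. -/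
noncomputable def betaR (d : ℕ) (τ α R : ℝ) : ℝ :=
  (1 + 4 * R ^ 2 / (α * τ ^ 2) + 4 * R) ^ ((α + d) / 2)

/-!
Write `γ_x` for `studentT d x τ α`, `γ = γ_0`, `K = α τ²` and `w` for the unnormalised density of
`γ`.

**Centred distribution.** That `γ` satisfies some weighted Poincaré inequality is proved without
spectral theory. On a ball `w` is bounded above and below, and the Poincaré inequality on convex
sets (`exists_lintegral_sub_sq_le_of_convex`) applies. Far out, the dilation `z ↦ 2z` contracts the
measure: `2 ^ d * w (2z) ≤ q * w z` with `q < 1`, because the ratio tends to `2 ^ (-α)`. Since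
`|f (2z) - f z|²` is controlled by the values of `‖z‖² ‖∇f‖²` on the segment `[z, 2z]`, this gives a
Hardy-type inequality for the tail (`lintegral_compl_closedBall_sq_le`). It uses exactly the weight
`‖z‖²` and works for every `α > 0`.

**Translates.** If `‖x‖ ≤ R`, then `1 + ‖z‖² ≤ (1 + R + R²) (1 + ‖z + x‖²)`, and the inequality for
`γ` applied to `f (· + x)` is the one for `γ_x` (`WeightedPoincare.studentT_translate`).

**Mixtures.** For `x`, `y` in the ball of radius `R` the density of `γ_x` is at most
`M = (1 + 4 R² / K + 2 R / √K) ^ ((α + d) / 2)` times that of `γ_y`, and `M ≤ κ_R + β_R`. Hence, for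
the mixture `π` and every `y` in the ball, with `m` the mean of `f` under `γ_y`,
`Var_π f ≤ ∫ (f - m)² dπ ≤ M Var_{γ_y} f ≤ M C ∫ ‖∇f‖² ω dγ_y`. Integrating over `y` with respect to
the mixing measure gives the result (`weightedPoincare_conv_studentT`).
-/

/-! ### Increments of a function controlled by its derivative -/

section Increments

variable {E : Type*} [NormedAddCommGroup E] [NormedSpace ℝ E]

theorem sq_lintegral_le_lintegral_sq {Ω : Type*} [MeasurableSpace Ω] {μ : Measure Ω}
    [IsProbabilityMeasure μ] {h : Ω → ENNReal} (hh : AEMeasurable h μ) :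
    (∫⁻ t, h t ∂μ) ^ 2 ≤ ∫⁻ t, h t ^ 2 ∂μ := by
  have key := ENNReal.lintegral_mul_le_Lp_mul_Lq μ Real.HolderConjugate.two_two hh
    (aemeasurable_const (b := (1 : ENNReal)))
  simp only [Pi.mul_apply, mul_one, ENNReal.one_rpow, lintegral_const, measure_univ] at key
  calc (∫⁻ t, h t ∂μ) ^ 2 ≤ ((∫⁻ t, h t ^ (2 : ℝ) ∂μ) ^ (1 / 2 : ℝ)) ^ 2 := by gcongr
    _ = ∫⁻ t, h t ^ 2 ∂μ := by
      rw [← ENNReal.rpow_natCast, ← ENNReal.rpow_mul]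
      norm_num

/-- The fundamental theorem of calculus along the segment from `x` to `x + v`, followed by Jensen's
inequality. -/
theorem enorm_sub_sq_le_lintegral_fderiv {f : E → ℝ} (hf : ContDiff ℝ 1 f) (x v : E) :
    ‖f (x + v) - f x‖ₑ ^ 2 ≤
      ∫⁻ t in Set.Ioc (0 : ℝ) 1, ‖fderiv ℝ f (x + t • v)‖ₑ ^ 2 * ‖v‖ₑ ^ 2 := by
  have hcont : Continuous fun t : ℝ => fderiv ℝ f (x + t • v) :=
    (hf.continuous_fderiv one_ne_zero).comp (by fun_prop)
  have hderiv : ∀ t : ℝ, HasDerivAt (fun t : ℝ => f (x + t • v)) (fderiv ℝ f (x + t • v) v) t := by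
    intro t
    have h1 : HasDerivAt (fun t : ℝ => x + t • v) v t := by
      simpa using ((hasDerivAt_id t).smul_const v).const_add x
    exact ((hf.differentiable one_ne_zero _).hasFDerivAt).comp_hasDerivAt t h1
  have hint : ∫ t in (0 : ℝ)..1, fderiv ℝ f (x + t • v) v = f (x + v) - f x := by
    rw [intervalIntegral.integral_eq_sub_of_hasDerivAt (fun t _ => hderiv t)
      ((hcont.clm_apply continuous_const).intervalIntegrable _ _)]
    simp
  have : IsProbabilityMeasure (volume.restrict (Set.Ioc (0 : ℝ) 1)) := ⟨by simp⟩
  calc ‖f (x + v) - f x‖ₑ ^ 2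
      ≤ (∫⁻ t in Set.Ioc (0 : ℝ) 1, ‖fderiv ℝ f (x + t • v)‖ₑ * ‖v‖ₑ) ^ 2 := by
        rw [← hint, intervalIntegral.integral_of_le zero_le_one]
        gcongr
        refine (enorm_integral_le_lintegral_enorm _).trans (lintegral_mono fun t => ?_)
        exact ContinuousLinearMap.le_opENorm _ _
    _ ≤ _ := by
        refine (sq_lintegral_le_lintegral_sq (by fun_prop)).trans (lintegral_mono fun t => ?_)
        rw [mul_pow]

/-- Young's inequality. The parameter `θ` is kept free: a small `θ` leaves the first square with a
factor close to `1`, so that it can be absorbed in the tail estimate. -/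
theorem enorm_add_sq_le (a b : ℝ) {θ : ℝ} (hθ : 0 < θ) :
    ‖a + b‖ₑ ^ 2 ≤ ENNReal.ofReal (1 + θ) * ‖a‖ₑ ^ 2 + ENNReal.ofReal (1 + θ⁻¹) * ‖b‖ₑ ^ 2 := by
  simp only [← ofReal_norm]
  rw [← ENNReal.ofReal_pow (norm_nonneg _), ← ENNReal.ofReal_pow (norm_nonneg _),
    ← ENNReal.ofReal_pow (norm_nonneg _), ← ENNReal.ofReal_mul (by positivity),
    ← ENNReal.ofReal_mul (by positivity), ← ENNReal.ofReal_add (by positivity) (by positivity)]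
  apply ENNReal.ofReal_le_ofReal
  simp only [Real.norm_eq_abs, sq_abs]
  have h : (1 + θ) * a ^ 2 + (1 + θ⁻¹) * b ^ 2 - (a + b) ^ 2 = θ⁻¹ * (θ * a - b) ^ 2 := by
    field_simp; ring
  have : 0 ≤ θ⁻¹ * (θ * a - b) ^ 2 := by positivity
  linarith

theorem enorm_add_sq_le_two_mul (a b : ℝ) : ‖a + b‖ₑ ^ 2 ≤ 2 * ‖a‖ₑ ^ 2 + 2 * ‖b‖ₑ ^ 2 := by
  simpa [one_add_one_eq_two] using enorm_add_sq_le a b one_pos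

end Increments

/-! ### Poincaré inequality on convex sets and a dyadic tail estimate -/

section Haar

variable {E : Type*} [NormedAddCommGroup E] [NormedSpace ℝ E] [FiniteDimensional ℝ E]
  [MeasurableSpace E] [BorelSpace E] (μ : Measure E) [μ.IsAddHaarMeasure]

open Module Metric

theorem lintegral_comp_smul_add (g : E → ENNReal) {a : ℝ} (ha : 0 < a) (b : E) :
    ∫⁻ x, g (a • x + b) ∂μ = ENNReal.ofReal ((a ^ finrank ℝ E)⁻¹) * ∫⁻ x, g x ∂μ := by
  have h1 := lintegral_map_equiv (μ := μ) (fun y => g (y + b))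
    (Homeomorph.smulOfNeZero a ha.ne' : E ≃ₜ E).toMeasurableEquiv
  have h2 : (μ.map (Homeomorph.smulOfNeZero a ha.ne' : E ≃ₜ E).toMeasurableEquiv) =
      ENNReal.ofReal (abs (a ^ finrank ℝ E)⁻¹) • μ := Measure.map_addHaar_smul μ ha.ne'
  rw [h2, lintegral_smul_measure, lintegral_add_right_eq_self, abs_of_pos (by positivity)] at h1
  simpa using h1.symm

/-- For fixed `y ∈ s`, the increment of `f` from the midpoint of `x` and `y` to `x` is controlled by
`fderiv ℝ f` at the points `a • x + (1 - a) • y` with `a ∈ [1/2, 1]`. Stopping at the midpoint keeps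
`a` away from `0`, so that the change of variables `x ↦ a • x + (1 - a) • y` costs at most
`2 ^ dim E`. -/
theorem lintegral_sub_midpoint_sq_le {f : E → ℝ} (hf : ContDiff ℝ 1 f) {s : Set E}
    (hs : Convex ℝ s) (hsm : MeasurableSet s) {D : NNReal}
    (hD : ∀ x ∈ s, ∀ y ∈ s, ‖x - y‖ ≤ D) {y : E} (hy : y ∈ s) :
    ∫⁻ x in s, ‖f x - f (midpoint ℝ x y)‖ₑ ^ 2 ∂μ ≤
      D ^ 2 * 2 ^ finrank ℝ E * ∫⁻ x in s, ‖fderiv ℝ f x‖ₑ ^ 2 ∂μ := by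
  have hfd : Continuous (fderiv ℝ f) := hf.continuous_fderiv one_ne_zero
  set G : E → ENNReal := s.indicator fun x => ‖fderiv ℝ f x‖ₑ ^ 2 with hG
  have hGm : Measurable G := Measurable.indicator (by fun_prop) hsm
  have hpt : ∀ x ∈ s, ‖f x - f (midpoint ℝ x y)‖ₑ ^ 2 ≤
      ∫⁻ t in Set.Ioc (0 : ℝ) 1, D ^ 2 * G (((1 + t) / 2) • x + ((1 - t) / 2) • y) := by
    intro x hx
    have hv : ‖(2⁻¹ : ℝ) • (x - y)‖ₑ ≤ D := by
      rw [← ofReal_norm, ← ENNReal.ofReal_coe_nnreal]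
      apply ENNReal.ofReal_le_ofReal
      rw [norm_smul]
      have := hD x hx y hy
      have h0 := norm_nonneg (x - y)
      norm_num
      linarith
    have hm : midpoint ℝ x y + (2⁻¹ : ℝ) • (x - y) = x := by
      rw [midpoint_eq_smul_add, invOf_eq_inv]; module
    have h := enorm_sub_sq_le_lintegral_fderiv hf (midpoint ℝ x y) ((2⁻¹ : ℝ) • (x - y))
    rw [hm] at h
    refine h.trans (setLIntegral_mono_ae (by fun_prop) (Filter.Eventually.of_forall ?_))
    intro t ht
    have hpos : midpoint ℝ x y + t • (2⁻¹ : ℝ) • (x - y) =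
        ((1 + t) / 2) • x + ((1 - t) / 2) • y := by
      rw [midpoint_eq_smul_add, invOf_eq_inv]; module
    have hmem : ((1 + t) / 2) • x + ((1 - t) / 2) • y ∈ s :=
      hs hx hy (by linarith [ht.1]) (by linarith [ht.2]) (by ring)
    rw [hpos, hG, Set.indicator_of_mem hmem, mul_comm]
    gcongr
  calc ∫⁻ x in s, ‖f x - f (midpoint ℝ x y)‖ₑ ^ 2 ∂μ
      ≤ ∫⁻ x in s, ∫⁻ t in Set.Ioc (0 : ℝ) 1,
          D ^ 2 * G (((1 + t) / 2) • x + ((1 - t) / 2) • y) ∂volume ∂μ :=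
        setLIntegral_mono' hsm hpt
    _ ≤ ∫⁻ x, ∫⁻ t in Set.Ioc (0 : ℝ) 1,
          D ^ 2 * G (((1 + t) / 2) • x + ((1 - t) / 2) • y) ∂volume ∂μ :=
        setLIntegral_le_lintegral _ _
    _ = ∫⁻ t in Set.Ioc (0 : ℝ) 1, ∫⁻ x,
          D ^ 2 * G (((1 + t) / 2) • x + ((1 - t) / 2) • y) ∂μ := by
        refine lintegral_lintegral_swap (Measurable.aemeasurable ?_)
        exact (hGm.comp (by fun_prop : Measurable fun p : E × ℝ =>
          ((1 + p.2) / 2) • p.1 + ((1 - p.2) / 2) • y)).const_mul _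
    _ ≤ ∫⁻ t in Set.Ioc (0 : ℝ) 1, D ^ 2 * 2 ^ finrank ℝ E * ∫⁻ x, G x ∂μ := by
        refine setLIntegral_mono' measurableSet_Ioc fun t ht => ?_
        have ht0 : 0 < (1 + t) / 2 := by linarith [ht.1]
        rw [lintegral_const_mul _ (by fun_prop), lintegral_comp_smul_add μ G ht0, mul_assoc]
        gcongr
        rw [← inv_pow, ENNReal.ofReal_pow (by positivity)]
        gcongr
        rw [← ENNReal.ofReal_ofNat 2]
        apply ENNReal.ofReal_le_ofReal
        rw [inv_div, div_le_iff₀ (by linarith [ht.1])]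
        linarith [ht.1]
    _ = _ := by
        rw [lintegral_const, hG, lintegral_indicator hsm]
        simp

/-- Poincaré inequality on a bounded convex set. The double integral of `|f x - f y|²` is bounded by
comparing both values with the one at the midpoint; the constant `c` is `f y` for a point `y` at
which the inner integral is at most its average. -/
theorem exists_lintegral_sub_sq_le_of_convex {f : E → ℝ} (hf : ContDiff ℝ 1 f) {s : Set E}
    (hs : Convex ℝ s) (hsm : MeasurableSet s) (h0 : μ s ≠ 0) (htop : μ s ≠ ⊤) {D : NNReal}
    (hD : ∀ x ∈ s, ∀ y ∈ s, ‖x - y‖ ≤ D) :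
    ∃ c, ∫⁻ x in s, ‖f x - c‖ₑ ^ 2 ∂μ ≤
      4 * (D ^ 2 * 2 ^ finrank ℝ E) * ∫⁻ x in s, ‖fderiv ℝ f x‖ₑ ^ 2 ∂μ := by
  have hfc : Continuous f := hf.continuous
  set A : ENNReal := D ^ 2 * 2 ^ finrank ℝ E * ∫⁻ x in s, ‖fderiv ℝ f x‖ₑ ^ 2 ∂μ with hA
  have hmp : Continuous fun p : E × E => midpoint ℝ p.1 p.2 := by
    simp only [midpoint_eq_smul_add]; fun_prop
  obtain ⟨H, hH⟩ : ∃ H : E → E → ENNReal, H = fun x y => ‖f x - f (midpoint ℝ x y)‖ₑ ^ 2 :=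
    ⟨_, rfl⟩
  have hHm : Measurable (Function.uncurry H) := by
    rw [hH]
    exact ((hfc.comp continuous_fst).sub (hfc.comp hmp)).enorm.measurable.pow_const 2
  have hHm' : Measurable fun p : E × E => H p.2 p.1 := hHm.comp measurable_swap
  have hHs : ∀ y ∈ s, ∫⁻ x in s, H x y ∂μ ≤ A := fun y hy => by
    rw [hH]
    exact lintegral_sub_midpoint_sq_le μ hf hs hsm hD hy
  have hm1 : Measurable fun y => ∫⁻ x in s, H x y ∂μ := hHm'.lintegral_prod_right'
  have hm3 : Measurable fun y => ∫⁻ x in s, H y x ∂μ := hHm.lintegral_prod_right'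
  have hswap : ∫⁻ y in s, ∫⁻ x in s, H y x ∂μ ∂μ = ∫⁻ y in s, ∫⁻ x in s, H x y ∂μ ∂μ :=
    lintegral_lintegral_swap hHm.aemeasurable
  have hdouble : ∫⁻ y in s, ∫⁻ x in s, ‖f x - f y‖ₑ ^ 2 ∂μ ∂μ ≤ 4 * A * μ s := by
    calc ∫⁻ y in s, ∫⁻ x in s, ‖f x - f y‖ₑ ^ 2 ∂μ ∂μ
        ≤ ∫⁻ y in s, ∫⁻ x in s, (2 * H x y + 2 * H y x) ∂μ ∂μ := by
          refine lintegral_mono fun y => lintegral_mono fun x => ?_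
          have := enorm_add_sq_le_two_mul (f x - f (midpoint ℝ x y)) (f (midpoint ℝ y x) - f y)
          rw [midpoint_comm y x, sub_add_sub_cancel, ← midpoint_comm y x, midpoint_comm y x,
            enorm_sub_rev (f (midpoint ℝ x y)) (f y)] at this
          simpa only [hH, midpoint_comm y x] using this
      _ = 2 * ∫⁻ y in s, ∫⁻ x in s, H x y ∂μ ∂μ + 2 * ∫⁻ y in s, ∫⁻ x in s, H y x ∂μ ∂μ := by
          rw [← lintegral_const_mul _ hm1, ← lintegral_const_mul _ hm3,
            ← lintegral_add_left (hm1.const_mul 2)]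
          refine lintegral_congr fun y => ?_
          have hy1 : Measurable fun x => H x y :=
            hHm.comp (by fun_prop : Measurable fun x => (x, y))
          have hy2 : Measurable fun x => H y x :=
            hHm.comp (by fun_prop : Measurable fun x => (y, x))
          rw [lintegral_add_left (hy1.const_mul 2), lintegral_const_mul _ hy1,
            lintegral_const_mul _ hy2]
      _ = 4 * ∫⁻ y in s, ∫⁻ x in s, H x y ∂μ ∂μ := by
          rw [hswap, ← add_mul, two_add_two_eq_four]
      _ ≤ 4 * ∫⁻ y in s, A ∂μ := by
          gcongr 4 * ?_
          exact setLIntegral_mono' hsm hHs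
      _ = 4 * A * μ s := by rw [setLIntegral_const, ← mul_assoc]
  have hm2 : Measurable fun y => ∫⁻ x in s, ‖f x - f y‖ₑ ^ 2 ∂μ :=
    Measurable.lintegral_prod_right' (f := fun p : E × E => ‖f p.2 - f p.1‖ₑ ^ 2)
      (((hfc.comp continuous_snd).sub (hfc.comp continuous_fst)).enorm.measurable.pow_const 2)
  obtain ⟨y, -, hy⟩ := exists_le_setLAverage h0 htop hm2.aemeasurable
  refine ⟨f y, hy.trans ?_⟩
  rw [setLAverage_eq]
  refine ENNReal.div_le_of_le_mul (hdouble.trans ?_)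
  rw [hA]
  exact le_of_eq (by ring)

/-- Dyadic increments `f (2z) - f z` are controlled by the energy with weight `‖z‖²`, for every
density `w` that is doubling along rays. -/
theorem lintegral_comp_two_smul_sub_sq_le {f : E → ℝ} (hf : ContDiff ℝ 1 f) {w : E → ENNReal}
    (hw : Measurable w) {A : ENNReal}
    (hA : ∀ z, ∀ t ∈ Set.Ioc (0 : ℝ) 1, w z ≤ A * w ((1 + t) • z)) :
    ∫⁻ z, ‖f ((2 : ℝ) • z) - f z‖ₑ ^ 2 * w z ∂μ ≤
      A * ∫⁻ z, ‖fderiv ℝ f z‖ₑ ^ 2 * ‖z‖ₑ ^ 2 * w z ∂μ := by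
  have hfd : Continuous (fderiv ℝ f) := hf.continuous_fderiv one_ne_zero
  set G : E → ENNReal := fun z => ‖fderiv ℝ f z‖ₑ ^ 2 * ‖z‖ₑ ^ 2 * w z with hG
  have hGm : Measurable G := by fun_prop
  have hpt : ∀ z, ‖f ((2 : ℝ) • z) - f z‖ₑ ^ 2 * w z ≤
      ∫⁻ t in Set.Ioc (0 : ℝ) 1, A * G ((1 + t) • z) := by
    intro z
    have h := enorm_sub_sq_le_lintegral_fderiv hf z z
    rw [← two_smul ℝ z] at h
    refine (mul_le_mul_left h (w z)).trans ?_
    rw [← lintegral_mul_const _ (by fun_prop)]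
    refine setLIntegral_mono' measurableSet_Ioc fun t ht => ?_
    have hz : z + t • z = (1 + t) • z := by module
    have hn : ‖z‖ₑ ≤ ‖(1 + t) • z‖ₑ := by
      rw [← ofReal_norm, ← ofReal_norm]
      apply ENNReal.ofReal_le_ofReal
      rw [norm_smul, Real.norm_of_nonneg (by linarith [ht.1])]
      nlinarith [norm_nonneg z, ht.1]
    rw [hz, hG]
    calc ‖fderiv ℝ f ((1 + t) • z)‖ₑ ^ 2 * ‖z‖ₑ ^ 2 * w z
        ≤ ‖fderiv ℝ f ((1 + t) • z)‖ₑ ^ 2 * ‖(1 + t) • z‖ₑ ^ 2 * (A * w ((1 + t) • z)) := by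
          gcongr
          exact hA z t ht
      _ = _ := by ring
  calc ∫⁻ z, ‖f ((2 : ℝ) • z) - f z‖ₑ ^ 2 * w z ∂μ
      ≤ ∫⁻ z, ∫⁻ t in Set.Ioc (0 : ℝ) 1, A * G ((1 + t) • z) ∂volume ∂μ := lintegral_mono hpt
    _ = ∫⁻ t in Set.Ioc (0 : ℝ) 1, ∫⁻ z, A * G ((1 + t) • z) ∂μ := by
        refine lintegral_lintegral_swap (Measurable.aemeasurable ?_)
        exact (hGm.comp (by fun_prop : Measurable fun p : E × ℝ => (1 + p.2) • p.1)).const_mul _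
    _ ≤ ∫⁻ t in Set.Ioc (0 : ℝ) 1, A * ∫⁻ z, G z ∂μ := by
        refine setLIntegral_mono' measurableSet_Ioc fun t ht => ?_
        rw [lintegral_const_mul _ (by fun_prop)]
        gcongr A * ?_
        have h := lintegral_comp_smul_add μ G (a := 1 + t) (by linarith [ht.1]) 0
        simp only [add_zero] at h
        rw [h]
        refine mul_le_of_le_one_left' (ENNReal.ofReal_le_one.2 ?_)
        exact inv_le_one_of_one_le₀ (one_le_pow₀ (by linarith [ht.1]))
    _ = _ := by simp

/-- A Hardy-type inequality. If the dilation `z ↦ 2z` contracts the measure `w dμ` by a factor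
`q < 1` outside a ball, the tail of `∫ f² w` is controlled by its part in the doubled ball and by
the energy with weight `‖z‖²`: the tail beyond radius `2ρ` is the integral of `f (2z)²` against a
measure that is at most `q w dμ` beyond radius `ρ`, and `f (2z)` differs from `f z` by a dyadic
increment. The resulting multiple `(1 + q) / 2` of the (finite) tail itself is absorbed. -/
theorem lintegral_compl_closedBall_sq_le {f : E → ℝ} (hf : ContDiff ℝ 1 f) {w : E → ENNReal}
    (hw : Measurable w) {ρ q : ℝ} (hq0 : 0 < q) (hq1 : q < 1) {A : ENNReal}
    (hq : ∀ z, ρ < ‖z‖ → 2 ^ finrank ℝ E * w ((2 : ℝ) • z) ≤ ENNReal.ofReal q * w z)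
    (hA : ∀ z, ∀ t ∈ Set.Ioc (0 : ℝ) 1, w z ≤ A * w ((1 + t) • z))
    (hfin : ∫⁻ z, ‖f z‖ₑ ^ 2 * w z ∂μ ≠ ⊤) :
    ∫⁻ z in (closedBall 0 ρ)ᶜ, ‖f z‖ₑ ^ 2 * w z ∂μ ≤ ENNReal.ofReal (2 / (1 - q)) *
      (∫⁻ z in closedBall 0 (2 * ρ), ‖f z‖ₑ ^ 2 * w z ∂μ + ENNReal.ofReal (1 + 2 / (1 - q)) *
        (A * ∫⁻ z, ‖fderiv ℝ f z‖ₑ ^ 2 * ‖z‖ₑ ^ 2 * w z ∂μ)) := by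
  have hfc : Continuous f := hf.continuous
  set F : E → ENNReal := fun z => ‖f z‖ₑ ^ 2 * w z with hF
  have hFm : Measurable F := by fun_prop
  set S : Set E := (closedBall 0 ρ)ᶜ with hS
  have hSm : MeasurableSet S := measurableSet_closedBall.compl
  set I := ∫⁻ z in S, F z ∂μ
  set J := ∫⁻ z in closedBall 0 (2 * ρ), F z ∂μ with hJ
  set T := A * ∫⁻ z, ‖fderiv ℝ f z‖ₑ ^ 2 * ‖z‖ₑ ^ 2 * w z ∂μ
  have hIfin : I ≠ ⊤ := ((setLIntegral_le_lintegral _ _).trans_lt hfin.lt_top).ne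
  -- With this parameter in Young's inequality, `q * (1 + θ) ≤ (1 + q) / 2 < 1`.
  have hθ : 0 < (1 - q) / 2 := by linarith
  have hsplit : I ≤ J + ∫⁻ z in (closedBall 0 (2 * ρ))ᶜ, F z ∂μ := by
    rw [hJ, lintegral_add_compl _ measurableSet_closedBall]
    exact setLIntegral_le_lintegral _ _
  have hscale : ∫⁻ z in (closedBall 0 (2 * ρ))ᶜ, F z ∂μ =
      ∫⁻ z in S, 2 ^ finrank ℝ E * F ((2 : ℝ) • z) ∂μ := by
    rw [← lintegral_indicator measurableSet_closedBall.compl, ← lintegral_indicator hSm]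
    have h := lintegral_comp_smul_add μ ((closedBall (0 : E) (2 * ρ))ᶜ.indicator F) two_pos 0
    have hm : Measurable fun z : E =>
        (closedBall (0 : E) (2 * ρ))ᶜ.indicator F ((2 : ℝ) • z + 0) :=
      (hFm.indicator measurableSet_closedBall.compl).comp
        (by fun_prop : Measurable fun z : E => (2 : ℝ) • z + 0)
    have hc : (2 : ENNReal) ^ finrank ℝ E * ENNReal.ofReal ((2 ^ finrank ℝ E)⁻¹) = 1 := by
      rw [ENNReal.ofReal_inv_of_pos (by positivity), ENNReal.ofReal_pow zero_le_two,
        ENNReal.ofReal_ofNat]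
      exact ENNReal.mul_inv_cancel (by simp) (by simp)
    rw [← one_mul (∫⁻ x, (closedBall (0 : E) (2 * ρ))ᶜ.indicator F x ∂μ), ← hc, mul_assoc, ← h,
      ← lintegral_const_mul _ hm]
    refine lintegral_congr fun z => ?_
    have hiff : (2 : ℝ) • z + 0 ∈ (closedBall (0 : E) (2 * ρ))ᶜ ↔ z ∈ S := by
      simp [hS, norm_smul]
    by_cases hz : z ∈ S
    · rw [Set.indicator_of_mem hz, Set.indicator_of_mem (hiff.2 hz), add_zero]
    · rw [Set.indicator_of_notMem hz, Set.indicator_of_notMem (mt hiff.1 hz), mul_zero]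
  have hcontr : ∫⁻ z in S, 2 ^ finrank ℝ E * F ((2 : ℝ) • z) ∂μ ≤
      ENNReal.ofReal ((1 + q) / 2) * I + ENNReal.ofReal (1 + 2 / (1 - q)) * T := by
    calc ∫⁻ z in S, 2 ^ finrank ℝ E * F ((2 : ℝ) • z) ∂μ
        ≤ ∫⁻ z in S, (ENNReal.ofReal ((1 + q) / 2) * F z + ENNReal.ofReal (1 + 2 / (1 - q)) *
            (‖f ((2 : ℝ) • z) - f z‖ₑ ^ 2 * w z)) ∂μ := by
          refine setLIntegral_mono' hSm fun z hz => ?_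
          have hz' : ρ < ‖z‖ := by simpa [hS] using hz
          have hy := enorm_add_sq_le (f z) (f ((2 : ℝ) • z) - f z) hθ
          rw [add_sub_cancel, inv_div] at hy
          calc 2 ^ finrank ℝ E * F ((2 : ℝ) • z)
              = ‖f ((2 : ℝ) • z)‖ₑ ^ 2 * (2 ^ finrank ℝ E * w ((2 : ℝ) • z)) := by
                rw [hF]; ring
            _ ≤ _ := mul_le_mul' hy (hq z hz')
            _ = (ENNReal.ofReal q * ENNReal.ofReal (1 + (1 - q) / 2)) * F z +
                ENNReal.ofReal q * (ENNReal.ofReal (1 + 2 / (1 - q)) *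
                  (‖f ((2 : ℝ) • z) - f z‖ₑ ^ 2 * w z)) := by rw [hF]; ring
            _ ≤ _ := by
                refine add_le_add (mul_le_mul_left ?_ _) ?_
                · rw [← ENNReal.ofReal_mul hq0.le]
                  exact ENNReal.ofReal_le_ofReal (by nlinarith)
                · exact mul_le_of_le_one_left' (ENNReal.ofReal_le_one.2 hq1.le)
      _ = ENNReal.ofReal ((1 + q) / 2) * I + ENNReal.ofReal (1 + 2 / (1 - q)) *
            ∫⁻ z in S, ‖f ((2 : ℝ) • z) - f z‖ₑ ^ 2 * w z ∂μ := by
          have hm : Measurable fun z => ‖f ((2 : ℝ) • z) - f z‖ₑ ^ 2 * w z := by fun_prop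
          rw [lintegral_add_left (hFm.const_mul _), lintegral_const_mul _ hFm,
            lintegral_const_mul _ hm]
      _ ≤ _ := by
          gcongr
          exact (setLIntegral_le_lintegral _ _).trans
            (lintegral_comp_two_smul_sub_sq_le μ hf hw hA)
  -- The tail occurs on both sides with coefficients `1` and `(1 + q) / 2`; it is finite, so it
  -- cancels.
  have habs : ENNReal.ofReal ((1 - q) / 2) * I ≤
      J + ENNReal.ofReal (1 + 2 / (1 - q)) * T := by
    have hne : ENNReal.ofReal ((1 + q) / 2) * I ≠ ⊤ :=
      ENNReal.mul_ne_top ENNReal.ofReal_ne_top hIfin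
    refine (ENNReal.add_le_add_iff_left hne).1 ?_
    rw [← add_mul, ← ENNReal.ofReal_add (by linarith) hθ.le]
    have : (1 + q) / 2 + (1 - q) / 2 = 1 := by ring
    rw [this, ENNReal.ofReal_one, one_mul, add_left_comm]
    refine hsplit.trans ?_
    rw [hscale]
    gcongr
  calc I = ENNReal.ofReal (2 / (1 - q)) * (ENNReal.ofReal ((1 - q) / 2) * I) := by
        have h1q : (1 - q) ≠ 0 := by linarith
        rw [← mul_assoc, ← ENNReal.ofReal_mul (by rw [← inv_div]; positivity)]
        have : 2 / (1 - q) * ((1 - q) / 2) = 1 := by field_simp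
        rw [this, ENNReal.ofReal_one, one_mul]
    _ ≤ _ := by gcongr

end Haar

/-! ### The weighted Poincaré inequality in terms of lower Lebesgue integrals -/

section Bridge

theorem lintegral_enorm_sq_ne_top_of_memLp {Ω : Type*} [MeasurableSpace Ω] {μ : Measure Ω}
    {f : Ω → ℝ} (hf : MemLp f 2 μ) : ∫⁻ z, ‖f z‖ₑ ^ 2 ∂μ ≠ ⊤ := by
  have h := lintegral_rpow_enorm_lt_top_of_eLpNorm_lt_top two_ne_zero ENNReal.ofNat_ne_top
    hf.eLpNorm_lt_top
  simpa using h.ne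

theorem evariance_le_lintegral_sub_sq {Ω : Type*} [MeasurableSpace Ω] {μ : Measure Ω}
    [IsProbabilityMeasure μ] {f : Ω → ℝ} (hf : MemLp f 2 μ) (c : ℝ) :
    evariance f μ ≤ ∫⁻ z, ‖f z - c‖ₑ ^ 2 ∂μ := by
  have hfc : MemLp (fun z => f z - c) 2 μ := hf.sub (memLp_const c)
  rw [← ofReal_variance hf, ← variance_sub_const hf.aestronglyMeasurable c]
  refine (ENNReal.ofReal_le_ofReal (variance_le_expectation_sq hfc.aestronglyMeasurable)).trans ?_
  simp only [Pi.pow_apply]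
  rw [ofReal_integral_eq_lintegral_ofReal hfc.integrable_sq
    (Filter.Eventually.of_forall fun z => sq_nonneg _)]
  refine lintegral_mono fun z => le_of_eq ?_
  rw [← ofReal_norm, ← ENNReal.ofReal_pow (norm_nonneg _), Real.norm_eq_abs, sq_abs]

variable {d : ℕ}

/-- The right-hand integral `∫ ‖∇f‖² (1 + ‖z‖²) dμ` of the weighted Poincaré inequality as a lower
Lebesgue integral, so that infinite energy is the value `⊤`; the gradient is replaced by the Fréchet
derivative, which has the same norm. -/
noncomputable def weightedEnergy (f : EuclideanSpace ℝ (Fin d) → ℝ)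
    (μ : Measure (EuclideanSpace ℝ (Fin d))) : ENNReal :=
  ∫⁻ z, ‖fderiv ℝ f z‖ₑ ^ 2 * ENNReal.ofReal (quadWeight z) ∂μ

theorem quadWeight_nonneg (z : EuclideanSpace ℝ (Fin d)) : 0 ≤ quadWeight z := by
  unfold quadWeight; positivity

theorem continuous_quadWeight : Continuous (quadWeight (d := d)) := by
  unfold quadWeight; fun_prop

theorem measurable_weightedEnergy_integrand {f : EuclideanSpace ℝ (Fin d) → ℝ}
    (hf : ContDiff ℝ 1 f) :
    Measurable fun z => ‖fderiv ℝ f z‖ₑ ^ 2 * ENNReal.ofReal (quadWeight z) := by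
  have hfd : Continuous (fderiv ℝ f) := hf.continuous_fderiv one_ne_zero
  have := continuous_quadWeight (d := d)
  fun_prop

/-- The energy has to be assumed finite on the right as well, since `0 * ⊤ = 0` when `C = 0`. -/
theorem weightedPoincare_iff {μ : Measure (EuclideanSpace ℝ (Fin d))} [IsFiniteMeasure μ] {C : ℝ} :
    WeightedPoincare μ quadWeight C ↔ 0 ≤ C ∧ ∀ f : EuclideanSpace ℝ (Fin d) → ℝ,
      ContDiff ℝ 1 f → MemLp f 2 μ → weightedEnergy f μ ≠ ⊤ →
        evariance f μ ≤ ENNReal.ofReal C * weightedEnergy f μ := by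
  refine and_congr_right fun hC => forall₃_congr fun f hf hL => ?_
  have hgrad : ∀ z, ‖gradient f z‖ = ‖fderiv ℝ f z‖ := fun z => by
    rw [gradient, LinearIsometryEquiv.norm_map]
  have hfd : Continuous (fderiv ℝ f) := hf.continuous_fderiv one_ne_zero
  have hq := continuous_quadWeight (d := d)
  simp only [hgrad]
  have hnn : ∀ z, 0 ≤ ‖fderiv ℝ f z‖ ^ 2 * quadWeight z := fun z =>
    mul_nonneg (sq_nonneg _) (quadWeight_nonneg z)
  have hof : ∫⁻ z, ENNReal.ofReal (‖fderiv ℝ f z‖ ^ 2 * quadWeight z) ∂μ = weightedEnergy f μ := by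
    refine lintegral_congr fun z => ?_
    rw [ENNReal.ofReal_mul (sq_nonneg _), ENNReal.ofReal_pow (norm_nonneg _), ofReal_norm]
  have hint : Integrable (fun z => ‖fderiv ℝ f z‖ ^ 2 * quadWeight z) μ ↔
      weightedEnergy f μ ≠ ⊤ := by
    rw [Integrable, hasFiniteIntegral_iff_ofReal (Filter.Eventually.of_forall hnn), hof,
      lt_top_iff_ne_top]
    exact and_iff_right (by fun_prop : Continuous _).aestronglyMeasurable
  rw [← hint]
  refine forall_congr' fun hi => ?_
  rw [← hof, ← ofReal_integral_eq_lintegral_ofReal hi (Filter.Eventually.of_forall hnn),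
    ← ENNReal.ofReal_mul hC, ← ofReal_variance hL,
    ENNReal.ofReal_le_ofReal_iff (mul_nonneg hC (integral_nonneg hnn))]

end Bridge

/-! ### The Student distribution as a normalised density -/

section StudentT

variable {d : ℕ} {τ α : ℝ}

/-- The unnormalised density of `studentT d m τ α`, with values in `ℝ≥0∞`. -/
noncomputable def studentWeight (d : ℕ) (m : EuclideanSpace ℝ (Fin d)) (τ α : ℝ)
    (z : EuclideanSpace ℝ (Fin d)) : ENNReal :=
  ENNReal.ofReal ((1 + ‖z - m‖ ^ 2 / (α * τ ^ 2)) ^ (-(α + d) / 2))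

theorem rpow_neg_le_of_le_mul {a b c p : ℝ} (ha : 0 < a) (hc : 0 < c) (hp : 0 ≤ p)
    (h : a ≤ c * b) : b ^ (-p) ≤ c ^ p * a ^ (-p) := by
  have h1 : a / c ≤ b := by rwa [div_le_iff₀' hc]
  calc b ^ (-p) ≤ (a / c) ^ (-p) := Real.rpow_le_rpow_of_nonpos (by positivity) h1 (by linarith)
    _ = c ^ p * a ^ (-p) := by
      rw [Real.div_rpow ha.le hc.le, Real.rpow_neg hc.le, div_inv_eq_mul, mul_comm]

/-- A comparison of the quadratic bases of two Student densities turns into a comparison of the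
densities, possibly with different centres and at different points: this covers dilations,
translates and lower bounds on balls. -/
theorem studentWeight_le_mul (hα : 0 < α) (hτ : 0 < τ) {m m' z z' : EuclideanSpace ℝ (Fin d)}
    {c : ℝ} (hc : 0 < c)
    (h : 1 + ‖z - m‖ ^ 2 / (α * τ ^ 2) ≤ c * (1 + ‖z' - m'‖ ^ 2 / (α * τ ^ 2))) :
    studentWeight d m' τ α z' ≤ ENNReal.ofReal (c ^ ((α + d) / 2)) * studentWeight d m τ α z := by
  unfold studentWeight
  rw [← ENNReal.ofReal_mul (by positivity), neg_div]
  exact ENNReal.ofReal_le_ofReal (rpow_neg_le_of_le_mul (by positivity) hc (by positivity) h)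

theorem measurable_studentWeight (m : EuclideanSpace ℝ (Fin d)) :
    Measurable (studentWeight d m τ α) := by
  unfold studentWeight; fun_prop

/-- The normalising constant of `studentT d m τ α`, which does not depend on `m`. -/
noncomputable def studentMass (d : ℕ) (τ α : ℝ) : ENNReal :=
  ∫⁻ z, studentWeight d 0 τ α z

theorem lintegral_studentWeight (m : EuclideanSpace ℝ (Fin d)) :
    ∫⁻ z, studentWeight d m τ α z = studentMass d τ α := by
  have h := lintegral_sub_right_eq_self (μ := volume) (studentWeight d 0 τ α) m
  simpa [studentMass, studentWeight] using h

theorem studentMass_ne_zero (hα : 0 < α) (hτ : 0 < τ) : studentMass d τ α ≠ 0 := by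
  intro h
  rw [studentMass, lintegral_eq_zero_iff (measurable_studentWeight 0)] at h
  obtain ⟨z, hz⟩ := h.exists
  have : 0 < studentWeight d 0 τ α z := ENNReal.ofReal_pos.2 (by positivity)
  exact this.ne' hz

theorem studentMass_ne_top (hα : 0 < α) (hτ : 0 < τ) : studentMass d τ α ≠ ⊤ := by
  have hint := integrable_rpow_neg_one_add_norm_sq (E := EuclideanSpace ℝ (Fin d)) (μ := volume)
    (r := α + d) (by simpa using hα)
  set K := α * τ ^ 2 with hK
  have hK0 : 0 < K := by positivity
  have hle : ∀ z : EuclideanSpace ℝ (Fin d), studentWeight d 0 τ α z ≤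
      ENNReal.ofReal ((1 + K) ^ ((α + d) / 2)) *
        ENNReal.ofReal ((1 + ‖z‖ ^ 2) ^ (-(α + d) / 2)) := by
    intro z
    rw [studentWeight, ← ENNReal.ofReal_mul (by positivity), neg_div, sub_zero]
    refine ENNReal.ofReal_le_ofReal
      (rpow_neg_le_of_le_mul (by positivity) (by positivity) (by positivity) ?_)
    rw [← hK]
    have : (1 + K) * (1 + ‖z‖ ^ 2 / K) = 1 + ‖z‖ ^ 2 + (K + ‖z‖ ^ 2 / K) := by
      field_simp; ring
    have : 0 ≤ ‖z‖ ^ 2 / K := by positivity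
    linarith
  refine ((lintegral_mono hle).trans_lt ?_).ne
  rw [lintegral_const_mul _ (by fun_prop)]
  refine ENNReal.mul_lt_top ENNReal.ofReal_lt_top ?_
  have := hint.lintegral_lt_top
  exact this

theorem studentT_eq (m : EuclideanSpace ℝ (Fin d)) :
    studentT d m τ α =
      (studentMass d τ α)⁻¹ • volume.withDensity (studentWeight d m τ α) := by
  rw [← lintegral_studentWeight m, ← setLIntegral_univ,
    ← withDensity_apply _ MeasurableSet.univ]
  rfl

theorem lintegral_studentT (m : EuclideanSpace ℝ (Fin d)) {g : EuclideanSpace ℝ (Fin d) → ENNReal}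
    (hg : Measurable g) :
    ∫⁻ z, g z ∂(studentT d m τ α) =
      (studentMass d τ α)⁻¹ * ∫⁻ z, g z * studentWeight d m τ α z := by
  rw [studentT_eq, lintegral_smul_measure,
    lintegral_withDensity_eq_lintegral_mul _ (measurable_studentWeight m) hg]
  simp [mul_comm]

theorem lintegral_studentT_add (m : EuclideanSpace ℝ (Fin d))
    {g : EuclideanSpace ℝ (Fin d) → ENNReal} (hg : Measurable g) :
    ∫⁻ z, g (z + m) ∂(studentT d 0 τ α) = ∫⁻ z, g z ∂(studentT d m τ α) := by
  rw [lintegral_studentT 0 (by fun_prop), lintegral_studentT m hg,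
    ← lintegral_add_right_eq_self (fun z => g z * studentWeight d m τ α z) m]
  simp [studentWeight]

theorem isProbabilityMeasure_studentT (hα : 0 < α) (hτ : 0 < τ) (m : EuclideanSpace ℝ (Fin d)) :
    IsProbabilityMeasure (studentT d m τ α) := by
  constructor
  rw [← lintegral_one, lintegral_studentT m measurable_const]
  simp only [one_mul]
  rw [lintegral_studentWeight, ENNReal.inv_mul_cancel (studentMass_ne_zero hα hτ)
    (studentMass_ne_top hα hτ)]

theorem measurePreserving_add_studentT (m : EuclideanSpace ℝ (Fin d)) :
    MeasurePreserving (fun z => z + m) (studentT d 0 τ α) (studentT d m τ α) := by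
  refine ⟨by fun_prop, Measure.ext_of_lintegral _ fun g hg => ?_⟩
  rw [lintegral_map hg (by fun_prop), lintegral_studentT_add m hg]

end StudentT

/-! ### A weighted Poincaré inequality for the centred Student distribution -/

section Existence

open Module Metric

variable {d : ℕ} {τ α : ℝ}

/-- The ratio of `2 ^ d * w (2z)` to `w z` tends to `2 ^ (-α) < 1` at infinity, so outside a large
ball it is at most `q = 2 ^ (-α / 2)`. -/
theorem exists_studentWeight_two_smul_le (hα : 0 < α) (hτ : 0 < τ) :
    ∃ ρ q : ℝ, 0 < ρ ∧ 0 < q ∧ q < 1 ∧ ∀ z : EuclideanSpace ℝ (Fin d), ρ < ‖z‖ →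
      2 ^ d * studentWeight d 0 τ α ((2 : ℝ) • z) ≤
        ENNReal.ofReal q * studentWeight d 0 τ α z := by
  set K := α * τ ^ 2 with hK
  have hK0 : 0 < K := by positivity
  set p := (α + d) / 2 with hp
  have hp0 : 0 < p := by positivity
  -- `b` is chosen so that `2 ^ d * b ^ p = 2 ^ (-α / 2)`. It exceeds `1 / 4`, the limit at infinity
  -- of `(1 + r² / K) / (1 + 4 r² / K)`, so this quotient is at most `b` for large `r`.
  set b : ℝ := ((2 : ℝ) ^ (-(d + α / 2))) ^ p⁻¹
  have hb0 : 0 < b := by positivity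
  have hbp : b ^ p = (2 : ℝ) ^ (-(d + α / 2)) :=
    Real.rpow_inv_rpow (by positivity) hp0.ne'
  have hb4 : 1 / 4 < b := by
    by_contra hcon
    have h1 : b ^ p ≤ (1 / 4 : ℝ) ^ p := Real.rpow_le_rpow hb0.le (not_lt.1 hcon) hp0.le
    have h2 : (1 / 4 : ℝ) ^ p = (2 : ℝ) ^ (-(d + α)) := by
      rw [show (1 / 4 : ℝ) = (2 : ℝ) ^ (-2 : ℝ) by
        rw [Real.rpow_neg zero_le_two]; norm_num, ← Real.rpow_mul zero_le_two, hp]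
      congr 1; ring
    rw [h2, hbp, Real.rpow_le_rpow_left_iff one_lt_two] at h1
    linarith
  have h4b : 0 < 4 * b - 1 := by linarith
  have hq : (2 : ℝ) ^ d * b ^ p = (2 : ℝ) ^ (-(α / 2)) := by
    rw [hbp, ← Real.rpow_natCast, ← Real.rpow_add two_pos]
    congr 1; ring
  refine ⟨Real.sqrt (K / (4 * b - 1)), (2 : ℝ) ^ (-(α / 2)), by positivity, by positivity,
    Real.rpow_lt_one_of_one_lt_of_neg one_lt_two (by linarith), fun z hz => ?_⟩
  have hz2 : K ≤ ‖z‖ ^ 2 * (4 * b - 1) := by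
    rw [← div_le_iff₀ h4b]
    exact (Real.sqrt_le_left (norm_nonneg z)).1 hz.le
  have hmain := studentWeight_le_mul (m := 0) (m' := 0) (z := z) (z' := (2 : ℝ) • z) hα hτ hb0 (by
    rw [← hK, sub_zero, sub_zero, norm_smul, Real.norm_ofNat]
    have h1 : 1 ≤ ‖z‖ ^ 2 * (4 * b - 1) / K := by rwa [one_le_div hK0]
    have h2 : b * (1 + (2 * ‖z‖) ^ 2 / K) =
      b + ‖z‖ ^ 2 / K + ‖z‖ ^ 2 * (4 * b - 1) / K := by ring
    linarith)
  rw [← hq, ENNReal.ofReal_mul (by positivity), ENNReal.ofReal_pow zero_le_two,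
    ENNReal.ofReal_ofNat, mul_assoc]
  gcongr

theorem studentWeight_le_add_one_smul (hα : 0 < α) (hτ : 0 < τ) (z : EuclideanSpace ℝ (Fin d))
    {t : ℝ} (ht : t ∈ Set.Ioc (0 : ℝ) 1) :
    studentWeight d 0 τ α z ≤
      ENNReal.ofReal (4 ^ ((α + d) / 2)) * studentWeight d 0 τ α ((1 + t) • z) := by
  refine studentWeight_le_mul hα hτ (by norm_num) ?_
  have hK0 : 0 < α * τ ^ 2 := by positivity
  rw [sub_zero, sub_zero, norm_smul, Real.norm_of_nonneg (by linarith [ht.1])]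
  have h1 : ((1 + t) * ‖z‖) ^ 2 ≤ 4 * ‖z‖ ^ 2 := by
    rw [mul_pow]
    gcongr
    nlinarith [ht.1, ht.2]
  have h2 : ((1 + t) * ‖z‖) ^ 2 / (α * τ ^ 2) ≤ 4 * ‖z‖ ^ 2 / (α * τ ^ 2) := by gcongr
  have h3 : 4 * (1 + ‖z‖ ^ 2 / (α * τ ^ 2)) = 4 + 4 * ‖z‖ ^ 2 / (α * τ ^ 2) := by ring
  linarith

theorem studentWeight_le_one (hα : 0 < α) (hτ : 0 < τ) (z : EuclideanSpace ℝ (Fin d)) :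
    studentWeight d 0 τ α z ≤ 1 := by
  refine ENNReal.ofReal_le_one.2 (Real.rpow_le_one_of_one_le_of_nonpos ?_ ?_)
  · have : 0 ≤ ‖z - 0‖ ^ 2 / (α * τ ^ 2) := by positivity
    linarith
  · have : 0 ≤ α + d := by positivity
    linarith

theorem one_le_mul_studentWeight (hα : 0 < α) (hτ : 0 < τ) {r : ℝ}
    {z : EuclideanSpace ℝ (Fin d)} (hz : ‖z‖ ≤ r) :
    1 ≤ ENNReal.ofReal ((1 + r ^ 2 / (α * τ ^ 2)) ^ ((α + d) / 2)) * studentWeight d 0 τ α z := by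
  have hK0 : 0 < α * τ ^ 2 := by positivity
  have h0 : studentWeight d 0 τ α 0 = 1 := by simp [studentWeight]
  rw [← h0]
  refine studentWeight_le_mul hα hτ (by positivity) ?_
  simp only [sub_zero, norm_zero]
  have : ‖z‖ ^ 2 / (α * τ ^ 2) ≤ r ^ 2 / (α * τ ^ 2) := by gcongr
  simpa using this

theorem lintegral_sq_mul_studentWeight_ne_top (hα : 0 < α) (hτ : 0 < τ)
    {f : EuclideanSpace ℝ (Fin d) → ℝ} (hfm : Measurable f) (hf : MemLp f 2 (studentT d 0 τ α)) :
    ∫⁻ z, ‖f z‖ₑ ^ 2 * studentWeight d 0 τ α z ≠ ⊤ := by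
  have h := lintegral_enorm_sq_ne_top_of_memLp hf
  rw [lintegral_studentT 0 (by fun_prop)] at h
  exact fun htop => h (by
    rw [htop, ENNReal.mul_top (ENNReal.inv_ne_zero.2 (studentMass_ne_top hα hτ))])

/-- On a ball the Student density is bounded above and below, and the Poincaré inequality of the
ball provides the constant `c`; the complement is handled by the Hardy-type inequality applied to
`f - c`. -/
theorem exists_lintegral_sub_sq_le_weightedEnergy (hα : 0 < α) (hτ : 0 < τ) :
    ∃ C : ENNReal, C ≠ ⊤ ∧ ∀ f : EuclideanSpace ℝ (Fin d) → ℝ, ContDiff ℝ 1 f →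
      MemLp f 2 (studentT d 0 τ α) → ∃ c, ∫⁻ z, ‖f z - c‖ₑ ^ 2 ∂(studentT d 0 τ α) ≤
        C * weightedEnergy f (studentT d 0 τ α) := by
  obtain ⟨ρ, q, hρ, hq0, hq1, hq⟩ := exists_studentWeight_two_smul_le (d := d) hα hτ
  set w := studentWeight d 0 τ α
  have hwm : Measurable w := measurable_studentWeight 0
  set B := closedBall (0 : EuclideanSpace ℝ (Fin d)) (2 * ρ) with hB
  have hBm : MeasurableSet B := measurableSet_closedBall
  set A := ENNReal.ofReal (4 ^ ((α + d) / 2))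
  set L := ENNReal.ofReal ((1 + (2 * ρ) ^ 2 / (α * τ ^ 2)) ^ ((α + d) / 2))
  set D : NNReal := (4 * ρ).toNNReal with hD
  set P : ENNReal := 4 * (D ^ 2 * 2 ^ d) * L
  set Q := ENNReal.ofReal (2 / (1 - q))
  set N := ENNReal.ofReal (1 + 2 / (1 - q))
  refine ⟨P + Q * (P + N * A), by finiteness, fun f hf hL2 => ?_⟩
  have hprob := isProbabilityMeasure_studentT hα hτ (0 : EuclideanSpace ℝ (Fin d))
  have hfc : Continuous f := hf.continuous
  have hem := measurable_weightedEnergy_integrand hf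
  set e := fun z => ‖fderiv ℝ f z‖ₑ ^ 2 * ENNReal.ofReal (quadWeight z) with he
  set V := ∫⁻ z, e z * w z
  have hdiam : ∀ x ∈ B, ∀ y ∈ B, ‖x - y‖ ≤ D := by
    intro x hx y hy
    rw [hD, Real.coe_toNNReal _ (by positivity)]
    rw [hB, mem_closedBall_zero_iff] at hx hy
    exact (norm_sub_le x y).trans (by linarith)
  obtain ⟨c, hc⟩ := exists_lintegral_sub_sq_le_of_convex volume hf
    (convex_closedBall (0 : EuclideanSpace ℝ (Fin d)) (2 * ρ)) hBm
    (measure_closedBall_pos volume _ (by positivity)).ne' measure_closedBall_lt_top.ne hdiam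
  rw [finrank_euclideanSpace_fin] at hc
  have hone : ∀ z : EuclideanSpace ℝ (Fin d), 1 ≤ ENNReal.ofReal (quadWeight z) := fun z => by
    rw [ENNReal.one_le_ofReal, quadWeight]
    linarith [sq_nonneg ‖z‖]
  have hewm : Measurable fun z => e z * w z := hem.mul hwm
  have hlocal : ∫⁻ z in B, ‖f z - c‖ₑ ^ 2 * w z ≤ P * V := by
    calc ∫⁻ z in B, ‖f z - c‖ₑ ^ 2 * w z
        ≤ ∫⁻ z in B, ‖f z - c‖ₑ ^ 2 :=
          lintegral_mono fun z => mul_le_of_le_one_right' (studentWeight_le_one hα hτ z)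
      _ ≤ _ := hc
      _ ≤ 4 * (D ^ 2 * 2 ^ d) * ∫⁻ z in B, L * (e z * w z) := by
          gcongr 4 * (D ^ 2 * 2 ^ d) * ?_
          refine setLIntegral_mono' hBm fun z hz => ?_
          rw [mem_closedBall_zero_iff] at hz
          calc ‖fderiv ℝ f z‖ₑ ^ 2 = ‖fderiv ℝ f z‖ₑ ^ 2 * 1 * 1 := by simp
            _ ≤ ‖fderiv ℝ f z‖ₑ ^ 2 * ENNReal.ofReal (quadWeight z) * (L * w z) := by
                gcongr
                · exact hone z
                · exact one_le_mul_studentWeight hα hτ hz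
            _ = L * (e z * w z) := by rw [he]; ring
      _ ≤ P * V := by
          rw [lintegral_const_mul _ hewm, ← mul_assoc]
          gcongr
          exact setLIntegral_le_lintegral _ _
  have hfc1 : ContDiff ℝ 1 fun z => f z - c := hf.sub contDiff_const
  have htail := lintegral_compl_closedBall_sq_le volume hfc1 hwm hq0 hq1
    (by simpa using hq) (fun z t ht => studentWeight_le_add_one_smul hα hτ z ht)
    (lintegral_sq_mul_studentWeight_ne_top hα hτ hfc1.continuous.measurable
      (hL2.sub (memLp_const c)))
  simp only [fderiv_sub_const] at htail
  have hgrad : ∫⁻ z, ‖fderiv ℝ f z‖ₑ ^ 2 * ‖z‖ₑ ^ 2 * w z ≤ V := by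
    refine lintegral_mono fun z => ?_
    have hz : ‖z‖ₑ ^ 2 ≤ ENNReal.ofReal (quadWeight z) := by
      rw [← ofReal_norm, ← ENNReal.ofReal_pow (norm_nonneg _)]
      exact ENNReal.ofReal_le_ofReal (by unfold quadWeight; linarith)
    change _ ≤ ‖fderiv ℝ f z‖ₑ ^ 2 * ENNReal.ofReal (quadWeight z) * w z
    gcongr
  refine ⟨c, ?_⟩
  rw [weightedEnergy, lintegral_studentT 0 (by fun_prop), lintegral_studentT 0 hem, mul_left_comm]
  gcongr (studentMass d τ α)⁻¹ * ?_
  calc ∫⁻ z, ‖f z - c‖ₑ ^ 2 * w z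
      = (∫⁻ z in closedBall 0 ρ, ‖f z - c‖ₑ ^ 2 * w z) +
          ∫⁻ z in (closedBall 0 ρ)ᶜ, ‖f z - c‖ₑ ^ 2 * w z :=
        (lintegral_add_compl _ measurableSet_closedBall).symm
    _ ≤ P * V + Q * (P * V + N * (A * V)) := by
        refine add_le_add ((lintegral_mono_set
          (closedBall_subset_closedBall (by linarith : ρ ≤ 2 * ρ))).trans hlocal) (htail.trans ?_)
        gcongr
    _ = (P + Q * (P + N * A)) * V := by ring

theorem exists_weightedPoincare_studentT_zero (hα : 0 < α) (hτ : 0 < τ) :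
    ∃ C, WeightedPoincare (studentT d 0 τ α) quadWeight C := by
  have hprob := isProbabilityMeasure_studentT hα hτ (0 : EuclideanSpace ℝ (Fin d))
  obtain ⟨C, hC, h⟩ := exists_lintegral_sub_sq_le_weightedEnergy (d := d) hα hτ
  refine ⟨C.toReal, weightedPoincare_iff.2 ⟨ENNReal.toReal_nonneg, fun f hf hL _ => ?_⟩⟩
  obtain ⟨c, hc⟩ := h f hf hL
  rw [ENNReal.ofReal_toReal hC]
  exact (evariance_le_lintegral_sub_sq hL c).trans hc

end Existence

/-! ### Translates -/

section Translation

variable {d : ℕ} {τ α : ℝ}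

theorem quadWeight_le_mul_quadWeight_add {R : ℝ} {x : EuclideanSpace ℝ (Fin d)} (hx : ‖x‖ ≤ R)
    (z : EuclideanSpace ℝ (Fin d)) :
    quadWeight z ≤ (1 + R + R ^ 2) * quadWeight (z + x) := by
  unfold quadWeight
  have h : ‖z‖ ≤ ‖z + x‖ + R := by
    have := norm_sub_le (z + x) x
    rw [add_sub_cancel_right] at this
    linarith
  have hR : 0 ≤ R := (norm_nonneg x).trans hx
  have hs := norm_nonneg (z + x)
  have h2 : ‖z‖ ^ 2 ≤ (‖z + x‖ + R) ^ 2 := by gcongr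
  nlinarith [mul_nonneg hR (sq_nonneg (‖z + x‖ - 1)), mul_nonneg (sq_nonneg R) (sq_nonneg ‖z + x‖)]

theorem WeightedPoincare.studentT_translate (hα : 0 < α) (hτ : 0 < τ) {R C : ℝ}
    (h : WeightedPoincare (studentT d 0 τ α) quadWeight C) {x : EuclideanSpace ℝ (Fin d)}
    (hx : ‖x‖ ≤ R) :
    WeightedPoincare (studentT d x τ α) quadWeight ((1 + R + R ^ 2) * C) := by
  have hR : 0 ≤ R := (norm_nonneg x).trans hx
  have hprob0 := isProbabilityMeasure_studentT hα hτ (0 : EuclideanSpace ℝ (Fin d))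
  have hprob := isProbabilityMeasure_studentT hα hτ x
  have hmp := measurePreserving_add_studentT (τ := τ) (α := α) x
  rw [weightedPoincare_iff] at h ⊢
  refine ⟨mul_nonneg (by positivity) h.1, fun f hf hL hfin => ?_⟩
  have hg : ContDiff ℝ 1 fun z => f (z + x) := hf.comp (by fun_prop)
  have hgL : MemLp (fun z => f (z + x)) 2 (studentT d 0 τ α) := hL.comp_measurePreserving hmp
  have henergy : weightedEnergy (fun z => f (z + x)) (studentT d 0 τ α) ≤
      ENNReal.ofReal (1 + R + R ^ 2) * weightedEnergy f (studentT d x τ α) := by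
    have hem := measurable_weightedEnergy_integrand hf
    have hshift : Measurable fun z =>
        ‖fderiv ℝ f (z + x)‖ₑ ^ 2 * ENNReal.ofReal (quadWeight (z + x)) :=
      hem.comp (measurable_add_const x)
    rw [weightedEnergy, weightedEnergy, ← lintegral_studentT_add x hem,
      ← lintegral_const_mul _ hshift]
    refine lintegral_mono fun z => ?_
    rw [fderiv_comp_add_right, mul_left_comm, ← ENNReal.ofReal_mul (by positivity)]
    gcongr
    exact quadWeight_le_mul_quadWeight_add hx z
  have hvar : evariance f (studentT d x τ α) ≤
      evariance (fun z => f (z + x)) (studentT d 0 τ α) := by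
    refine (evariance_le_lintegral_sub_sq hL (∫ z, f (z + x) ∂(studentT d 0 τ α))).trans_eq ?_
    rw [evariance, ← lintegral_studentT_add x (by have := hf.continuous; fun_prop)]
  calc evariance f (studentT d x τ α) ≤ _ := hvar
    _ ≤ ENNReal.ofReal C * weightedEnergy (fun z => f (z + x)) (studentT d 0 τ α) :=
        h.2 _ hg hgL (henergy.trans_lt (ENNReal.mul_lt_top ENNReal.ofReal_lt_top
          hfin.lt_top)).ne
    _ ≤ ENNReal.ofReal C * (ENNReal.ofReal (1 + R + R ^ 2) * weightedEnergy f (studentT d x τ α)) :=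
        by gcongr
    _ = _ := by rw [← mul_assoc, mul_comm (1 + R + R ^ 2), ENNReal.ofReal_mul h.1]

end Translation

/-! ### Mixtures of translates -/

section Mixture

open Metric

variable {d : ℕ} {τ α R : ℝ}

/-- A bound, uniform in `z`, for the ratio of the quadratic bases of two translates. With `K = α τ²`
and `s = ‖z - y‖`, the mixed term `4 R s / K` is absorbed by `2 s / √K ≤ 1 + s² / K`. -/
theorem one_add_sq_div_le_ratioBound (hα : 0 < α) (hτ : 0 < τ) (hR : 0 ≤ R)
    {x y z : EuclideanSpace ℝ (Fin d)} (hx : ‖x‖ ≤ R) (hy : ‖y‖ ≤ R) :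
    1 + ‖z - x‖ ^ 2 / (α * τ ^ 2) ≤
      (1 + 4 * R ^ 2 / (α * τ ^ 2) + 2 * R / √(α * τ ^ 2)) * (1 + ‖z - y‖ ^ 2 / (α * τ ^ 2)) := by
  set k := √(α * τ ^ 2)
  have hk0 : 0 < k := by positivity
  have hK : α * τ ^ 2 = k ^ 2 := (Real.sq_sqrt (by positivity)).symm
  rw [hK]
  have h : ‖z - x‖ ≤ ‖z - y‖ + 2 * R := by
    have h1 := norm_add_le (z - y) (y - x)
    rw [sub_add_sub_cancel] at h1
    linarith [norm_sub_le y x]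
  have hs := norm_nonneg (z - y)
  set s := ‖z - y‖
  have h2 : ‖z - x‖ ^ 2 / k ^ 2 ≤ (s + 2 * R) ^ 2 / k ^ 2 := by gcongr
  have h3 : (1 + 4 * R ^ 2 / k ^ 2 + 2 * R / k) * (1 + s ^ 2 / k ^ 2) -
      (1 + (s + 2 * R) ^ 2 / k ^ 2) =
      4 * R ^ 2 / k ^ 2 * (s ^ 2 / k ^ 2) + 2 * R / k * (s / k - 1) ^ 2 := by
    field_simp; ring
  have h4 : 0 ≤ 4 * R ^ 2 / k ^ 2 * (s ^ 2 / k ^ 2) + 2 * R / k * (s / k - 1) ^ 2 := by positivity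
  linarith

/-- With `K = α τ²`, the left-hand side is at most `betaR` if `K ≥ 1` and at most `kappaR` if
`K ≤ 1`. -/
theorem ratioBound_rpow_le (hα : 0 < α) (hτ : 0 < τ) (hR : 0 ≤ R) :
    (1 + 4 * R ^ 2 / (α * τ ^ 2) + 2 * R / √(α * τ ^ 2)) ^ ((α + d) / 2) ≤
      kappaR d τ α R + betaR d τ α R := by
  have hκ : 0 ≤ kappaR d τ α R := by unfold kappaR; positivity
  have hβ : 0 ≤ betaR d τ α R := by unfold betaR; positivity
  set k := √(α * τ ^ 2)
  have hk0 : 0 < k := by positivity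
  have hK : α * τ ^ 2 = k ^ 2 := (Real.sq_sqrt (by positivity)).symm
  rcases le_total 1 k with h1 | h1
  · suffices (1 + 4 * R ^ 2 / (α * τ ^ 2) + 2 * R / k) ^ ((α + d) / 2) ≤ betaR d τ α R by linarith
    unfold betaR
    gcongr
    rw [div_le_iff₀ hk0]
    nlinarith
  · suffices (1 + 4 * R ^ 2 / (α * τ ^ 2) + 2 * R / k) ^ ((α + d) / 2) ≤ kappaR d τ α R by linarith
    unfold kappaR
    gcongr
    have h2 : (α + (τ ^ 2)⁻¹ * (2 * (4 * R ^ 2 + 1))) / α = 1 + (8 * R ^ 2 + 2) / (α * τ ^ 2) := by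
      field_simp; ring
    rw [h2, hK, add_assoc, add_le_add_iff_left, ← sub_nonneg]
    have h3 : (8 * R ^ 2 + 2) / k ^ 2 - (4 * R ^ 2 / k ^ 2 + 2 * R / k) =
        (4 * R ^ 2 + 2 - 2 * R * k) / k ^ 2 := by field_simp; ring
    rw [h3]
    apply div_nonneg _ (by positivity)
    nlinarith [sq_nonneg (R - k)]

/-- Any two translates with centres in the ball have densities within a factor `κ_R + β_R`. -/
theorem lintegral_studentT_le_mul (hα : 0 < α) (hτ : 0 < τ) (hR : 0 ≤ R)
    {x y : EuclideanSpace ℝ (Fin d)} (hx : ‖x‖ ≤ R) (hy : ‖y‖ ≤ R)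
    {g : EuclideanSpace ℝ (Fin d) → ENNReal} (hg : Measurable g) :
    ∫⁻ z, g z ∂(studentT d x τ α) ≤
      ENNReal.ofReal (kappaR d τ α R + betaR d τ α R) * ∫⁻ z, g z ∂(studentT d y τ α) := by
  rw [lintegral_studentT x hg, lintegral_studentT y hg, mul_left_comm]
  gcongr (studentMass d τ α)⁻¹ * ?_
  have hgm : Measurable fun z => g z * studentWeight d y τ α z :=
    hg.mul (measurable_studentWeight y)
  rw [← lintegral_const_mul _ hgm]
  refine lintegral_mono fun z => ?_
  rw [mul_left_comm]
  gcongr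
  refine (studentWeight_le_mul hα hτ (by positivity)
    (one_add_sq_div_le_ratioBound (z := z) hα hτ hR hy hx)).trans ?_
  gcongr
  exact ratioBound_rpow_le hα hτ hR

theorem lintegral_conv_studentT {ρ : Measure (EuclideanSpace ℝ (Fin d))} [SFinite ρ]
    [SFinite (studentT d 0 τ α)]
    {g : EuclideanSpace ℝ (Fin d) → ENNReal} (hg : Measurable g) :
    ∫⁻ z, g z ∂(Measure.conv ρ (studentT d 0 τ α)) =
      ∫⁻ x, ∫⁻ z, g z ∂(studentT d x τ α) ∂ρ := by
  rw [Measure.lintegral_conv hg]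
  refine lintegral_congr fun x => ?_
  rw [← lintegral_studentT_add x hg]
  simp only [add_comm]

/-- The mixture and every `γ_y` with `‖y‖ ≤ R` bound each other up to the factor `M = κ_R + β_R`.
The first comparison reduces the variance under the mixture to that under `γ_y`, the second one
shows that `f` is admissible for `γ_y`; averaging the resulting bounds over `y` turns the energies
under `γ_y` into the energy under the mixture. -/
theorem weightedPoincare_conv_studentT (hα : 0 < α) (hτ : 0 < τ) (hR : 0 ≤ R)
    {ρ : Measure (EuclideanSpace ℝ (Fin d))} [IsProbabilityMeasure ρ]
    (hρ : ρ (closedBall 0 R)ᶜ = 0) {C : ℝ}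
    (hC : ∀ x ∈ closedBall (0 : EuclideanSpace ℝ (Fin d)) R,
      WeightedPoincare (studentT d x τ α) quadWeight C) :
    WeightedPoincare (Measure.conv ρ (studentT d 0 τ α)) quadWeight
      (C * (kappaR d τ α R + betaR d τ α R)) := by
  have hprob := fun x : EuclideanSpace ℝ (Fin d) => isProbabilityMeasure_studentT hα hτ x
  have hC0 : 0 ≤ C := (hC 0 (mem_closedBall_self hR)).1
  have hκ : 0 ≤ kappaR d τ α R := by unfold kappaR; positivity
  have hβ : 0 ≤ betaR d τ α R := by unfold betaR; positivity
  set M := ENNReal.ofReal (kappaR d τ α R + betaR d τ α R)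
  have hae : ∀ᵐ x ∂ρ, x ∈ closedBall (0 : EuclideanSpace ℝ (Fin d)) R := hρ
  set π := Measure.conv ρ (studentT d 0 τ α) with hπ
  have hπle : ∀ y ∈ closedBall (0 : EuclideanSpace ℝ (Fin d)) R,
      ∀ g : EuclideanSpace ℝ (Fin d) → ENNReal, Measurable g →
        ∫⁻ z, g z ∂π ≤ M * ∫⁻ z, g z ∂(studentT d y τ α) := by
    intro y hy g hg
    rw [hπ, lintegral_conv_studentT hg]
    refine (lintegral_mono_ae (g := fun _ => M * ∫⁻ z, g z ∂(studentT d y τ α)) ?_).trans_eq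
      (by simp)
    filter_upwards [hae] with x hx
    exact lintegral_studentT_le_mul hα hτ hR (mem_closedBall_zero_iff.1 hx)
      (mem_closedBall_zero_iff.1 hy) hg
  have hleπ : ∀ y ∈ closedBall (0 : EuclideanSpace ℝ (Fin d)) R,
      ∀ g : EuclideanSpace ℝ (Fin d) → ENNReal, Measurable g →
        ∫⁻ z, g z ∂(studentT d y τ α) ≤ M * ∫⁻ z, g z ∂π := by
    intro y hy g hg
    rw [hπ, lintegral_conv_studentT hg, ← lintegral_const_mul' _ _ ENNReal.ofReal_ne_top]
    refine (Eq.trans_le (by simp) (lintegral_mono_ae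
      (f := fun _ => ∫⁻ z, g z ∂(studentT d y τ α)) ?_))
    filter_upwards [hae] with x hx
    exact lintegral_studentT_le_mul hα hτ hR (mem_closedBall_zero_iff.1 hy)
      (mem_closedBall_zero_iff.1 hx) hg
  refine weightedPoincare_iff.2 ⟨by positivity, fun f hf hL hfin => ?_⟩
  have hfc : Continuous f := hf.continuous
  have hem := measurable_weightedEnergy_integrand hf
  have hpt : ∀ y ∈ closedBall (0 : EuclideanSpace ℝ (Fin d)) R,
      evariance f π ≤ M * (ENNReal.ofReal C * weightedEnergy f (studentT d y τ α)) := by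
    intro y hy
    have hyle : studentT d y τ α ≤ M • π := Measure.le_iff.2 fun s hs => by
      simpa [lintegral_indicator hs] using
        hleπ y hy (s.indicator 1) (measurable_one.indicator hs)
    have hLy : MemLp f 2 (studentT d y τ α) := hL.of_measure_le_smul ENNReal.ofReal_ne_top hyle
    have hey : weightedEnergy f (studentT d y τ α) ≠ ⊤ :=
      ((hleπ y hy _ hem).trans_lt (ENNReal.mul_lt_top ENNReal.ofReal_lt_top hfin.lt_top)).ne
    calc evariance f π ≤ ∫⁻ z, ‖f z - ∫ u, f u ∂(studentT d y τ α)‖ₑ ^ 2 ∂π :=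
          evariance_le_lintegral_sub_sq hL _
      _ ≤ M * evariance f (studentT d y τ α) := hπle y hy _ (by fun_prop)
      _ ≤ _ := by
          gcongr
          exact (weightedPoincare_iff.1 (hC y hy)).2 f hf hLy hey
  calc evariance f π = ∫⁻ _, evariance f π ∂ρ := by simp
    _ ≤ ∫⁻ y, M * ENNReal.ofReal C * weightedEnergy f (studentT d y τ α) ∂ρ := by
        refine lintegral_mono_ae ?_
        filter_upwards [hae] with y hy
        rw [mul_assoc]
        exact hpt y hy
    _ = ENNReal.ofReal (C * (kappaR d τ α R + betaR d τ α R)) * weightedEnergy f π := by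
        rw [lintegral_const_mul' _ _ (by finiteness), ENNReal.ofReal_mul hC0,
          mul_comm (ENNReal.ofReal C), weightedEnergy, hπ, lintegral_conv_studentT hem]
        rfl

end Mixture

theorem mainTheorem11 (d : ℕ) (α τ R : ℝ) (hα : 0 < α) (hτ : 0 < τ) (hR : 0 ≤ R) :
    -- the translates of `t(0, τ² I, α)` to points of the ball have a common constant
    (∃ C : ℝ, ∀ x ∈ Metric.closedBall (0 : EuclideanSpace ℝ (Fin d)) R,
      WeightedPoincare (studentT d x τ α) quadWeight C) ∧
    -- such a common constant is obtained from any constant of `t(0, τ² I, α)` itself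
    (∀ C : ℝ, WeightedPoincare (studentT d 0 τ α) quadWeight C →
      ∀ x ∈ Metric.closedBall (0 : EuclideanSpace ℝ (Fin d)) R,
        WeightedPoincare (studentT d x τ α) quadWeight ((1 + R + R ^ 2) * C)) ∧
    ∀ (ρ : Measure (EuclideanSpace ℝ (Fin d))) [IsProbabilityMeasure ρ],
      ρ (Metric.closedBall 0 R)ᶜ = 0 →
      -- the convolution satisfies a weighted Poincaré inequality
      (∃ C : ℝ, WeightedPoincare (Measure.conv ρ (studentT d 0 τ α)) quadWeight C) ∧
      -- with the stated bound on its constant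
      (∀ C : ℝ, (∀ x ∈ Metric.closedBall (0 : EuclideanSpace ℝ (Fin d)) R,
          WeightedPoincare (studentT d x τ α) quadWeight C) →
        WeightedPoincare (Measure.conv ρ (studentT d 0 τ α)) quadWeight
          (C * (kappaR d τ α R + betaR d τ α R))) := by
  obtain ⟨C₀, hC₀⟩ := exists_weightedPoincare_studentT_zero (d := d) hα hτ
  have htrans : ∀ C : ℝ, WeightedPoincare (studentT d 0 τ α) quadWeight C →
      ∀ x ∈ Metric.closedBall (0 : EuclideanSpace ℝ (Fin d)) R,
        WeightedPoincare (studentT d x τ α) quadWeight ((1 + R + R ^ 2) * C) :=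
    fun C hC x hx => hC.studentT_translate hα hτ (mem_closedBall_zero_iff.1 hx)
  exact ⟨⟨_, htrans C₀ hC₀⟩, htrans, fun ρ _ hρ =>
    ⟨⟨_, weightedPoincare_conv_studentT hα hτ hR hρ (htrans C₀ hC₀)⟩,
      fun C hC => weightedPoincare_conv_studentT hα hτ hR hρ hC⟩⟩
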